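/- Let $C$ be a finite set of colours and $\Sigma$ a signature over $C$, i.e. a set of operations $o\colon w\to v$ with arity $w$ and coarity $v$ in $C^\star$ (finite words over $C$). A $C$-coloured prop is a strict symmetric monoidal category with object set $C^\star$, whose monoidal product on objects is concatenation and whose unit is the empty word. Morphisms of $C$-coloured props are identity-on-objects strict symmetric monoidal functors. Write $\mathsf{PROP}_C$ for the resulting category. Let $\mathbf S(\Sigma,C)$ be the free $C$-coloured prop on $\Sigma$, whose arrows are $\Sigma$-terms modulo the laws of symmetric monoidal categories. Let $\mathbf{Frob}_C$ be the $C$-coloured prop presented, for each $c\in C$, by operations $\mu_c\colon cc\to c$, $\eta_c\colon\varepsilon\to c$, $\delta_c\colon c\to cc$, $\epsilon_c\colon c\to\varepsilon$, where $\varepsilon$ is the empty word. The equations say that $(\mu_c,\eta_c)$ is a commutative monoid, that $(\delta_c,\epsilon_c)$ is a commutative comonoid, and that the Frobenius law $(\delta_c\oplus\mathrm{id});(\mathrm{id}\oplus\mu_c)=\mu_c;\delta_c=(\mathrm{id}\oplus\delta_c);(\mu_c\oplus\mathrm{id})$ and the separability law $\delta_c;\mu_c=\mathrm{id}_c$ hold.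 Let $\mathbf H(\Sigma,C)$, the free hypergraph category over $(\Sigma,C)$, be the free $C$-coloured prop on the disjoint union of $\Sigma$ and $\{\mu_c,\eta_c,\delta_c,\epsilon_c\mid c\in C\}$ modulo the same equations. A hypergraph category is a symmetric monoidal category in which every object carries a commutative monoid and a commutative comonoid structure satisfying the Frobenius and separability laws, compatibly with the monoidal product. A morphism of $C$-coloured props with hypergraph structure is a hypergraph morphism if it preserves these (co)multiplications and (co)units on every object. Then the coproduct $\mathbf S(\Sigma,C)+\mathbf{Frob}_C$ exists in $\mathsf{PROP}_C$. For every coproduct $P$ of $\mathbf S(\Sigma,C)$ and $\mathbf{Frob}_C$ in $\mathsf{PROP}_C$, with injections $i_1,i_2$, there is an isomorphism of $C$-coloured props $e\colon P\cong\mathbf H(\Sigma,C)$. It sends $i_1(o)$ to $o$ for $o\in\Sigma$, and $i_2(\mu_c),i_2(\eta_c),i_2(\delta_c),i_2(\epsilon_c)$ to $\mu_c,\eta_c,\delta_c,\epsilon_c$ for $c\in C$. Moreover, $P$ and $\mathbf H(\Sigma,C)$ carry hypergraph category structures that on each colour $c$ are given by the images of the Frobenius generators of colour $c$, such that $e$ and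 $e^{-1}$ are hypergraph morphisms. Finally, with this structure $P$ is the free hypergraph category on $(\Sigma,C)$: for every $C$-coloured prop $A$ with a hypergraph category structure and every assignment to each $o\colon w\to v$ in $\Sigma$ of an arrow $\varphi(o)\colon w\to v$ of $A$, there is a unique hypergraph morphism $F\colon P\to A$ with $F(i_1(o))=\varphi(o)$ for all $o\in\Sigma$. -/

import Mathlib

open CategoryTheory MonoidalCategory

universe v u

/-- A signature over a set `C` of colours: a set of operations `o : w → v`, each with an arity `w`
and a coarity `v`, which are words over `C`. Together with `C` this is a monoidal theory. -/
structure Signature (C : Type u) where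
  Op : Type u
  arity : Op → List C
  coarity : Op → List C

/-- Transport of an arrow along equalities of its source and target words. -/
def castHom {C : Type u} (H : List C → List C → Type u) {w w' v v' : List C}
    (hw : w = w') (hv : v = v') (f : H w v) : H w' v' :=
  hw ▸ hv ▸ f

/-- A `C`-coloured prop: a (strict) symmetric monoidal category whose objects are the words
over `C`, with word concatenation as the monoidal product on objects and the empty word as
the monoidal unit. Composition is written in diagrammatic order. -/
structure ColouredProp (C : Type u) where
  Hom : List C → List C → Type u
  id : ∀ w, Hom w w
  comp : ∀ {w v z}, Hom w v → Hom v z → Hom w z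
  tensor : ∀ {w v w' v'}, Hom w v → Hom w' v' → Hom (w ++ w') (v ++ v')
  sym : ∀ w v, Hom (w ++ v) (v ++ w)
  id_comp : ∀ {w v} (f : Hom w v), comp (id w) f = f
  comp_id : ∀ {w v} (f : Hom w v), comp f (id v) = f
  assoc : ∀ {w v z y} (f : Hom w v) (g : Hom v z) (h : Hom z y),
    comp (comp f g) h = comp f (comp g h)
  tensor_id : ∀ w v, tensor (id w) (id v) = id (w ++ v)
  tensor_comp : ∀ {w v z w' v' z'} (f : Hom w v) (g : Hom v z) (f' : Hom w' v') (g' : Hom v' z'),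
    tensor (comp f g) (comp f' g') = comp (tensor f f') (tensor g g')
  tensor_assoc : ∀ {w v w' v' w'' v''} (f : Hom w v) (g : Hom w' v') (h : Hom w'' v''),
    castHom Hom (List.append_assoc w w' w'') (List.append_assoc v v' v'')
      (tensor (tensor f g) h) = tensor f (tensor g h)
  unit_tensor : ∀ {w v} (f : Hom w v), tensor (id []) f = f
  tensor_unit : ∀ {w v} (f : Hom w v),
    castHom Hom (List.append_nil w) (List.append_nil v) (tensor f (id [])) = f
  sym_natural : ∀ {w v w' v'} (f : Hom w v) (g : Hom w' v'),
    comp (tensor f g) (sym v v') = comp (sym w w') (tensor g f)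
  sym_sym : ∀ w v, comp (sym w v) (sym v w) = id (w ++ v)
  hexagon : ∀ w v z,
    comp (castHom Hom (List.append_assoc w v z) (List.append_assoc v w z)
        (tensor (sym w v) (id z)))
      (tensor (id v) (sym w z)) =
    castHom Hom rfl (List.append_assoc v z w) (sym w (v ++ z))

namespace ColouredProp

variable {C : Type u}

/-- A morphism of `C`-coloured props: an identity-on-objects (strict) symmetric monoidal
functor. -/
@[ext]
structure Mor (P Q : ColouredProp C) where
  map : ∀ {w v}, P.Hom w v → Q.Hom w v
  map_id : ∀ w, map (P.id w) = Q.id w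
  map_comp : ∀ {w v z} (f : P.Hom w v) (g : P.Hom v z),
    map (P.comp f g) = Q.comp (map f) (map g)
  map_tensor : ∀ {w v w' v'} (f : P.Hom w v) (g : P.Hom w' v'),
    map (P.tensor f g) = Q.tensor (map f) (map g)
  map_sym : ∀ w v, map (P.sym w v) = Q.sym w v

/-- The category of `C`-coloured props. -/
instance : Category (ColouredProp C) where
  Hom := Mor
  id P :=
    { map := fun f => f
      map_id := fun _ => rfl
      map_comp := fun _ _ => rfl
      map_tensor := fun _ _ => rfl
      map_sym := fun _ _ => rfl }
  comp F G :=
    { map := fun f => G.map (F.map f)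
      map_id := fun w => by rw [F.map_id, G.map_id]
      map_comp := fun f g => by rw [F.map_comp, G.map_comp]
      map_tensor := fun f g => by rw [F.map_tensor, G.map_tensor]
      map_sym := fun w v => by rw [F.map_sym, G.map_sym] }

/-! ### The underlying symmetric monoidal category of a coloured prop -/

/-- The objects of a `C`-coloured prop, namely the words over `C`. -/
def Obj (_ : ColouredProp C) : Type u := List C

instance (P : ColouredProp C) : Category.{u} P.Obj where
  Hom w v := P.Hom w v
  id w := P.id w
  comp f g := P.comp f g
  id_comp f := P.id_comp f
  comp_id f := P.comp_id f
  assoc f g h := P.assoc f g h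

instance (P : ColouredProp C) : MonoidalCategoryStruct P.Obj where
  tensorObj w v := List.append w v
  whiskerLeft w _ _ f := P.tensor (P.id w) f
  whiskerRight f w := P.tensor f (P.id w)
  tensorHom f g := P.tensor f g
  tensorUnit := ([] : List C)
  associator w v z := eqToIso (List.append_assoc w v z)
  leftUnitor w := eqToIso (List.nil_append w)
  rightUnitor w := eqToIso (List.append_nil w)

theorem castHom_eq (P : ColouredProp C) {w w' v v' : P.Obj} (hw : w = w') (hv : v = v')
    (f : w ⟶ v) : castHom P.Hom hw hv f = eqToHom hw.symm ≫ f ≫ eqToHom hv := by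
  subst hw hv
  simp [castHom]

theorem eqToHom_tensor_id (P : ColouredProp C) {w v : P.Obj} (h : w = v) (z : P.Obj) :
    eqToHom h ⊗ₘ 𝟙 z = eqToHom (congrArg (fun t => t ⊗ z) h) := by
  subst h
  exact P.tensor_id _ _

theorem id_tensor_eqToHom (P : ColouredProp C) {w v : P.Obj} (h : w = v) (z : P.Obj) :
    𝟙 z ⊗ₘ eqToHom h = eqToHom (congrArg (fun t => z ⊗ t) h) := by
  subst h
  exact P.tensor_id _ _

theorem obj_assoc (P : ColouredProp C) (w v z : P.Obj) : (w ⊗ v) ⊗ z = w ⊗ (v ⊗ z) :=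
  List.append_assoc w v z

theorem obj_unit_tensor (P : ColouredProp C) (w : P.Obj) : 𝟙_ P.Obj ⊗ w = w :=
  List.nil_append w

theorem obj_tensor_unit (P : ColouredProp C) (w : P.Obj) : w ⊗ 𝟙_ P.Obj = w :=
  List.append_nil w

theorem associator_eq (P : ColouredProp C) (w v z : P.Obj) :
    α_ w v z = eqToIso (P.obj_assoc w v z) := rfl

theorem leftUnitor_eq (P : ColouredProp C) (w : P.Obj) :
    λ_ w = eqToIso (P.obj_unit_tensor w) := rfl

theorem rightUnitor_eq (P : ColouredProp C) (w : P.Obj) :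
    ρ_ w = eqToIso (P.obj_tensor_unit w) := rfl

theorem tensor_assoc' (P : ColouredProp C) {w v w' v' w'' v'' : P.Obj}
    (f : w ⟶ v) (g : w' ⟶ v') (h : w'' ⟶ v'') :
    eqToHom (P.obj_assoc w w' w'').symm ≫ ((f ⊗ₘ g) ⊗ₘ h) ≫ eqToHom (P.obj_assoc v v' v'') =
      (f ⊗ₘ (g ⊗ₘ h)) :=
  (castHom_eq P (P.obj_assoc w w' w'') (P.obj_assoc v v' v'') _).symm.trans
    (P.tensor_assoc f g h)

theorem tensor_unit' (P : ColouredProp C) {w v : P.Obj} (f : w ⟶ v) :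
    eqToHom (P.obj_tensor_unit w).symm ≫ (f ⊗ₘ 𝟙 (𝟙_ P.Obj)) ≫ eqToHom (P.obj_tensor_unit v) =
      f :=
  (castHom_eq P (P.obj_tensor_unit w) (P.obj_tensor_unit v) _).symm.trans (P.tensor_unit f)

/-- The symmetry isomorphism. -/
def swap (P : ColouredProp C) (w v : P.Obj) : w ⊗ v ≅ v ⊗ w :=
  ⟨P.sym w v, P.sym v w, P.sym_sym w v, P.sym_sym v w⟩

theorem hexagon' (P : ColouredProp C) (w v z : P.Obj) :
    eqToHom (P.obj_assoc w v z).symm ≫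
        (P.swap w v).hom ▷ z ≫ eqToHom (P.obj_assoc v w z) ≫
          v ◁ (P.swap w z).hom =
      (P.swap w (v ⊗ z)).hom ≫ eqToHom (P.obj_assoc v z w) := by
  have e := P.hexagon w v z
  have e₁ := castHom_eq P (P.obj_assoc w v z) (P.obj_assoc v w z)
    ((P.swap w v).hom ▷ z)
  have e₂ := castHom_eq P rfl (P.obj_assoc v z w)
    (P.swap w (v ⊗ z)).hom
  have e₃ := ((congrArg (fun t => t ≫ v ◁ (P.swap w z).hom) e₁).symm.trans
    e).trans e₂
  simpa only [Category.assoc, eqToHom_refl, Category.id_comp] using e₃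

/-- The underlying monoidal category; it is strict. -/
instance (P : ColouredProp C) : MonoidalCategory P.Obj :=
  MonoidalCategory.ofTensorHom
    (id_tensorHom_id := fun w v => P.tensor_id w v)
    (id_tensorHom := fun _ _ _ _ => rfl)
    (tensorHom_id := fun _ _ => rfl)
    (tensorHom_comp_tensorHom := fun f f' g g' => (P.tensor_comp f g f' g').symm)
    (associator_naturality := fun f g h => by
      rw [associator_eq, associator_eq, ← tensor_assoc']
      simp)
    (leftUnitor_naturality := fun {X Y} f => by
      have e : (𝟙 (𝟙_ P.Obj) ⊗ₘ f) = f := P.unit_tensor f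
      have h₁ : (λ_ X).hom = 𝟙 X := rfl
      have h₂ : (λ_ Y).hom = 𝟙 Y := rfl
      rw [h₁, h₂]
      exact (Category.comp_id _).trans (e.trans (Category.id_comp _).symm))
    (rightUnitor_naturality := fun f => by
      rw [rightUnitor_eq, rightUnitor_eq]
      conv_rhs => rw [← tensor_unit' P f]
      simp)
    (pentagon := fun W X Y Z => by
      simp only [associator_eq, eqToIso.hom, eqToHom_tensor_id, id_tensor_eqToHom,
        eqToHom_trans])
    (triangle := fun X Y => by
      simp only [associator_eq, leftUnitor_eq, rightUnitor_eq, eqToIso.hom, eqToHom_tensor_id,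
        id_tensor_eqToHom, eqToHom_trans])

theorem hexagon_forward (P : ColouredProp C) (w v z : P.Obj) :
    (α_ w v z).hom ≫ (P.swap w (v ⊗ z)).hom ≫ (α_ v z w).hom =
      (P.swap w v).hom ▷ z ≫ (α_ v w z).hom ≫
        v ◁ (P.swap w z).hom := by
  have e := hexagon' P w v z
  rw [associator_eq, associator_eq, associator_eq, eqToIso.hom, eqToIso.hom, eqToIso.hom, ← e]
  simp

/-- The underlying symmetric monoidal category. -/
instance (P : ColouredProp C) : SymmetricCategory P.Obj where
  braiding := P.swap
  braiding_naturality_right w _ _ f := P.sym_natural (P.id w) f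
  braiding_naturality_left f w := P.sym_natural f (P.id w)
  hexagon_forward w v z := hexagon_forward P w v z
  hexagon_reverse w v z := by
    have e : (α_ z w v ≪≫ P.swap z (w ⊗ v) ≪≫ α_ w v z) =
        (whiskerRightIso (P.swap z w) v ≪≫ α_ w z v ≪≫ whiskerLeftIso w (P.swap z v)) :=
      Iso.ext (by simpa using hexagon_forward P z w v)
    have e' := congrArg Iso.inv e
    have h (x y : P.Obj) : (P.swap x y).inv = (P.swap y x).hom := rfl
    simpa only [Iso.trans_inv, whiskerRightIso_inv, whiskerLeftIso_inv, Category.assoc, h]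
      using e'
  symmetry w v := P.sym_sym w v

end ColouredProp

/-! ### Terms and presented props -/

/-- Terms over a signature `S`: the closure of the operations of `S`, identities and symmetries
under sequential composition and monoidal product. -/
inductive Term {C : Type u} (S : Signature C) : List C → List C → Type u
  | op (o : S.Op) : Term S (S.arity o) (S.coarity o)
  | id (w : List C) : Term S w w
  | sym (w v : List C) : Term S (w ++ v) (v ++ w)
  | comp {w v z : List C} (a : Term S w v) (b : Term S v z) : Term S w z
  | tensor {w v w' v' : List C} (a : Term S w v) (b : Term S w' v') :
      Term S (w ++ w') (v ++ v')

/-- The congruence on terms generated by the laws of (strict) symmetric monoidal categories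
and by a family `E` of equations. -/
inductive TermEq {C : Type u} {S : Signature C}
    (E : ∀ w v : List C, Term S w v → Term S w v → Prop) :
    ∀ {w v : List C}, Term S w v → Term S w v → Prop
  | eqn {w v} {a b : Term S w v} : E w v a b → TermEq E a b
  | refl {w v} (a : Term S w v) : TermEq E a a
  | symm {w v} {a b : Term S w v} : TermEq E a b → TermEq E b a
  | trans {w v} {a b c : Term S w v} : TermEq E a b → TermEq E b c → TermEq E a c
  | comp_congr {w v z} {a a' : Term S w v} {b b' : Term S v z} :
      TermEq E a a' → TermEq E b b' → TermEq E (a.comp b) (a'.comp b')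
  | tensor_congr {w v w' v'} {a a' : Term S w v} {b b' : Term S w' v'} :
      TermEq E a a' → TermEq E b b' → TermEq E (a.tensor b) (a'.tensor b')
  | id_comp {w v} (a : Term S w v) : TermEq E ((Term.id w).comp a) a
  | comp_id {w v} (a : Term S w v) : TermEq E (a.comp (Term.id v)) a
  | assoc {w v z y} (a : Term S w v) (b : Term S v z) (c : Term S z y) :
      TermEq E ((a.comp b).comp c) (a.comp (b.comp c))
  | tensor_id (w v) : TermEq E ((Term.id w).tensor (Term.id v)) (Term.id (w ++ v))
  | tensor_comp {w v z w' v' z'} (a : Term S w v) (b : Term S v z)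
      (a' : Term S w' v') (b' : Term S v' z') :
      TermEq E ((a.comp b).tensor (a'.comp b')) ((a.tensor a').comp (b.tensor b'))
  | tensor_assoc {w v w' v' w'' v''} (a : Term S w v) (b : Term S w' v') (c : Term S w'' v'') :
      TermEq E
        (castHom (Term S) (List.append_assoc w w' w'') (List.append_assoc v v' v'')
          ((a.tensor b).tensor c))
        (a.tensor (b.tensor c))
  | unit_tensor {w v} (a : Term S w v) : TermEq E ((Term.id []).tensor a) a
  | tensor_unit {w v} (a : Term S w v) :
      TermEq E
        (castHom (Term S) (List.append_nil w) (List.append_nil v) (a.tensor (Term.id []))) a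
  | sym_natural {w v w' v'} (a : Term S w v) (b : Term S w' v') :
      TermEq E ((a.tensor b).comp (Term.sym v v')) ((Term.sym w w').comp (b.tensor a))
  | sym_sym (w v) : TermEq E ((Term.sym w v).comp (Term.sym v w)) (Term.id (w ++ v))
  | hexagon (w v z) :
      TermEq E
        ((castHom (Term S) (List.append_assoc w v z) (List.append_assoc v w z)
            ((Term.sym w v).tensor (Term.id z))).comp
          ((Term.id v).tensor (Term.sym w z)))
        (castHom (Term S) rfl (List.append_assoc v z w) (Term.sym w (v ++ z)))

theorem castHom_mk {C : Type u} (H : List C → List C → Type u)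
    (r : ∀ {w v : List C}, H w v → H w v → Prop) {w w' v v' : List C}
    (hw : w = w') (hv : v = v') (f : H w v) :
    castHom (fun w v => Quot (r (w := w) (v := v))) hw hv (Quot.mk _ f) =
      Quot.mk _ (castHom H hw hv f) := by
  subst hw hv
  rfl

/-- The `C`-coloured prop presented by the signature `S` and the equations `E`: arrows are terms
modulo the laws of symmetric monoidal categories and `E`. -/
def presentedProp {C : Type u} (S : Signature C)
    (E : ∀ w v : List C, Term S w v → Term S w v → Prop) : ColouredProp C where
  Hom w v := Quot (TermEq E (w := w) (v := v))
  id w := Quot.mk _ (Term.id w)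
  comp := Quot.map₂ Term.comp (fun a _ _ h => .comp_congr (.refl a) h)
    (fun _ _ b h => .comp_congr h (.refl b))
  tensor := Quot.map₂ Term.tensor (fun a _ _ h => .tensor_congr (.refl a) h)
    (fun _ _ b h => .tensor_congr h (.refl b))
  sym w v := Quot.mk _ (Term.sym w v)
  id_comp := by rintro w v ⟨a⟩; exact Quot.sound (.id_comp a)
  comp_id := by rintro w v ⟨a⟩; exact Quot.sound (.comp_id a)
  assoc := by rintro w v z y ⟨a⟩ ⟨b⟩ ⟨c⟩; exact Quot.sound (.assoc a b c)
  tensor_id w v := Quot.sound (.tensor_id w v)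
  tensor_comp := by
    rintro w v z w' v' z' ⟨a⟩ ⟨b⟩ ⟨a'⟩ ⟨b'⟩
    exact Quot.sound (.tensor_comp a b a' b')
  tensor_assoc := by
    rintro w v w' v' w'' v'' ⟨a⟩ ⟨b⟩ ⟨c⟩
    exact (castHom_mk (Term S) (TermEq E) _ _ _).trans (Quot.sound (.tensor_assoc a b c))
  unit_tensor := by rintro w v ⟨a⟩; exact Quot.sound (.unit_tensor a)
  tensor_unit := by
    rintro w v ⟨a⟩
    exact (castHom_mk (Term S) (TermEq E) _ _ _).trans (Quot.sound (.tensor_unit a))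
  sym_natural := by rintro w v w' v' ⟨a⟩ ⟨b⟩; exact Quot.sound (.sym_natural a b)
  sym_sym w v := Quot.sound (.sym_sym w v)
  hexagon w v z := by
    have h₁ := castHom_mk (Term S) (TermEq E) (List.append_assoc w v z) (List.append_assoc v w z)
      ((Term.sym w v).tensor (Term.id z))
    have h₂ := castHom_mk (Term S) (TermEq E) rfl (List.append_assoc v z w) (Term.sym w (v ++ z))
    refine Eq.trans ?_ (Eq.trans (Quot.sound (TermEq.hexagon (E := E) w v z)) h₂.symm)
    exact congrArg (fun t => Quot.map₂ Term.comp (fun a _ _ h => .comp_congr (.refl a) h)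
      (fun _ _ b h => .comp_congr h (.refl b)) t
      (Quot.mk _ ((Term.id v).tensor (Term.sym w z)))) h₁

/-- The arrow of a presented prop given by an operation of the signature. -/
def presentedProp.gen {C : Type u} {S : Signature C}
    {E : ∀ w v : List C, Term S w v → Term S w v → Prop} (o : S.Op) :
    (presentedProp S E).Hom (S.arity o) (S.coarity o) :=
  Quot.mk _ (Term.op o)

/-- The free `C`-coloured prop on the monoidal theory `(S, C)`. -/
def synProp {C : Type u} (S : Signature C) : ColouredProp C :=
  presentedProp S (fun _ _ _ _ => False)

/-! ### Separable Frobenius monoids and hypergraph categories -/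

/-- The operations of the theory of separable Frobenius monoids, one of each sort for every
colour. -/
inductive FrobOp (C : Type u) : Type u
  | mul (c : C)
  | one (c : C)
  | comul (c : C)
  | counit (c : C)

/-- The arity of a Frobenius operation. -/
def FrobOp.arity {C : Type u} : FrobOp C → List C
  | .mul c => [c, c]
  | .one _ => []
  | .comul c => [c]
  | .counit c => [c]

/-- The coarity of a Frobenius operation. -/
def FrobOp.coarity {C : Type u} : FrobOp C → List C
  | .mul c => [c]
  | .one c => [c]
  | .comul c => [c, c]
  | .counit _ => []

/-- The signature of separable Frobenius monoids. -/
def frobSignature (C : Type u) : Signature C where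
  Op := FrobOp C
  arity := FrobOp.arity
  coarity := FrobOp.coarity

/-- The equations of separable Frobenius monoids on all colours, where the Frobenius operations
are interpreted by the terms `ι o` over a signature `S`. -/
inductive FrobEq {C : Type u} {S : Signature C}
    (ι : ∀ o : FrobOp C, Term S o.arity o.coarity) :
    ∀ w v : List C, Term S w v → Term S w v → Prop
  | mul_comm (c) : FrobEq ι [c, c] [c]
      (.comp (.sym [c] [c]) (ι (.mul c))) (ι (.mul c))
  | one_mul (c) : FrobEq ι [c] [c]
      (.comp (.tensor (ι (.one c)) (.id [c])) (ι (.mul c))) (.id [c])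
  | mul_assoc (c) : FrobEq ι [c, c, c] [c]
      (.comp (.tensor (ι (.mul c)) (.id [c])) (ι (.mul c))) (.comp (.tensor (.id [c]) (ι (.mul c))) (ι (.mul c)))
  | comul_comm (c) : FrobEq ι [c] [c, c]
      (.comp (ι (.comul c)) (.sym [c] [c])) (ι (.comul c))
  | counit_comul (c) : FrobEq ι [c] [c]
      (.comp (ι (.comul c)) (.tensor (ι (.counit c)) (.id [c]))) (.id [c])
  | comul_assoc (c) : FrobEq ι [c] [c, c, c]
      (.comp (ι (.comul c)) (.tensor (ι (.comul c)) (.id [c])))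
      (.comp (ι (.comul c)) (.tensor (.id [c]) (ι (.comul c))))
  | frob_left (c) : FrobEq ι [c, c] [c, c]
      (.comp (.tensor (ι (.comul c)) (.id [c])) (.tensor (.id [c]) (ι (.mul c))))
      (.comp (ι (.mul c)) (ι (.comul c)))
  | frob_right (c) : FrobEq ι [c, c] [c, c]
      (.comp (.tensor (.id [c]) (ι (.comul c))) (.tensor (ι (.mul c)) (.id [c])))
      (.comp (ι (.mul c)) (ι (.comul c)))
  | separable (c) : FrobEq ι [c] [c]
      (.comp (ι (.comul c)) (ι (.mul c))) (.id [c])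

/-- The `C`-coloured prop of separable Frobenius monoids on all colours in `C`. -/
def frobProp (C : Type u) : ColouredProp C :=
  presentedProp (frobSignature C) (FrobEq fun o => Term.op (S := frobSignature C) o)

/-- The disjoint union of two signatures. -/
def Signature.sum {C : Type u} (S T : Signature C) : Signature C where
  Op := S.Op ⊕ T.Op
  arity := Sum.elim S.arity T.arity
  coarity := Sum.elim S.coarity T.coarity

/-- The free hypergraph category over `(S, C)`: the free `C`-coloured prop on the disjoint union
of `S` and the signature of Frobenius monoids, modulo the equations of separable Frobenius
monoids for each colour. -/
def freeHyp {C : Type u} (S : Signature C) : ColouredProp C :=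
  presentedProp (S.sum (frobSignature C))
    (FrobEq fun o => Term.op (S := S.sum (frobSignature C)) (Sum.inr o))

/-- A hypergraph category: a symmetric monoidal category in which each object carries a
commutative monoid and a commutative comonoid structure satisfying the Frobenius and the
separability law, and where these structures are compatible with the monoidal product. -/
class HypergraphCategory (A : Type u) [Category.{v} A] [MonoidalCategory A]
    [SymmetricCategory A] where
  monObj : ∀ X : A, MonObj X
  comonObj : ∀ X : A, ComonObj X
  isCommMonObj : ∀ X : A, IsCommMonObj X
  isCommComonObj : ∀ X : A, IsCommComonObj X
  frob_left : ∀ X : A,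
    (comonObj X).comul ▷ X ≫ (α_ X X X).hom ≫ X ◁ (monObj X).mul =
      (monObj X).mul ≫ (comonObj X).comul
  frob_right : ∀ X : A,
    X ◁ (comonObj X).comul ≫ (α_ X X X).inv ≫ (monObj X).mul ▷ X =
      (monObj X).mul ≫ (comonObj X).comul
  separable : ∀ X : A, (comonObj X).comul ≫ (monObj X).mul = 𝟙 X
  mul_tensor : ∀ X Y : A, (monObj (X ⊗ Y)).mul =
    tensorμ X Y X Y ≫ ((monObj X).mul ⊗ₘ (monObj Y).mul)
  one_tensor : ∀ X Y : A, (monObj (X ⊗ Y)).one =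
    (λ_ (𝟙_ A)).inv ≫ ((monObj X).one ⊗ₘ (monObj Y).one)
  comul_tensor : ∀ X Y : A, (comonObj (X ⊗ Y)).comul =
    ((comonObj X).comul ⊗ₘ (comonObj Y).comul) ≫ tensorμ X X Y Y
  counit_tensor : ∀ X Y : A, (comonObj (X ⊗ Y)).counit =
    ((comonObj X).counit ⊗ₘ (comonObj Y).counit) ≫ (λ_ (𝟙_ A)).hom

namespace ColouredProp

variable {C : Type u} (P : ColouredProp C) (hP : HypergraphCategory P.Obj)

/-- The multiplication on the word `w`, as an arrow of the prop. -/
def mulHom (w : List C) : P.Hom (w ++ w) w := (hP.monObj w).mul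

/-- The unit on the word `w`, as an arrow of the prop. -/
def oneHom (w : List C) : P.Hom [] w := (hP.monObj w).one

/-- The comultiplication on the word `w`, as an arrow of the prop. -/
def comulHom (w : List C) : P.Hom w (w ++ w) := (hP.comonObj w).comul

/-- The counit on the word `w`, as an arrow of the prop. -/
def counitHom (w : List C) : P.Hom w [] := (hP.comonObj w).counit

end ColouredProp

/-- The hypergraph structure `hP` on the prop `P` restricts, on each colour `c`, to the images
of the Frobenius operations of colour `c` under `φ`. -/
structure ExtendsFrob {C : Type u} {P : ColouredProp C} (hP : HypergraphCategory P.Obj)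
    (φ : ∀ o : FrobOp C, P.Hom o.arity o.coarity) : Prop where
  mul : ∀ c, P.mulHom hP [c] = φ (.mul c)
  one : ∀ c, P.oneHom hP [c] = φ (.one c)
  comul : ∀ c, P.comulHom hP [c] = φ (.comul c)
  counit : ∀ c, P.counitHom hP [c] = φ (.counit c)

/-- A morphism of `C`-coloured props that is a morphism of hypergraph categories: it preserves
the Frobenius structure on every object. -/
structure IsHypergraphMor {C : Type u} {P Q : ColouredProp C} (hP : HypergraphCategory P.Obj)
    (hQ : HypergraphCategory Q.Obj) (F : ColouredProp.Mor P Q) : Prop where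
  map_mul : ∀ w, F.map (P.mulHom hP w) = Q.mulHom hQ w
  map_one : ∀ w, F.map (P.oneHom hP w) = Q.oneHom hQ w
  map_comul : ∀ w, F.map (P.comulHom hP w) = Q.comulHom hQ w
  map_counit : ∀ w, F.map (P.counitHom hP w) = Q.counitHom hQ w

/-! The prop H(Σ,C) is itself a coproduct. A presented prop maps to `P` exactly as its generators
are interpreted in `P` subject to the equations (`presentedProp.lift`, `presentedProp.hom_ext`). The
generators of H(Σ,C) are those of Σ and the Frobenius ones, and its equations involve only the
latter. So an arrow out of it is a pair of arrows out of the two summands (`freeHyp.isColimit`).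
Existence of the coproduct and the isomorphism `e` follow by uniqueness of colimits.

What remains is to pass between Frobenius structure on colours and on all words. For existence,
commutative separable Frobenius structures are closed under tensor products (`FrobeniusObj.tensor`),
so structures on letters multiply up to words. The associators and unitors respect these structures;
since the ones needed are identities in a prop, the structure on a concatenation equals the tensor
of the structures (`wordFrobenius_append`).

For uniqueness, compatibility with the product determines a hypergraph structure on nonempty words
from that on letters, and forces the structure on the empty word to be trivial (`oneHom_nil` and its
companions). Hence a prop morphism is a hypergraph morphism as soon as it preserves the structure on
letters (`isHypergraphMor_of_frobOps`). Hypergraph morphisms out of P with prescribed values on Σ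
are therefore prop morphisms with prescribed restrictions to both summands, and the coproduct
supplies exactly one. -/

/-! ### Tensor products of Frobenius structures in a symmetric monoidal category -/

/-- A separable commutative Frobenius structure on an object of a symmetric monoidal category. -/
structure FrobeniusObj {A : Type u} [Category.{v} A] [MonoidalCategory A] [SymmetricCategory A]
    (X : A) where
  mon : MonObj X
  comon : ComonObj X
  comm : IsCommMonObj X
  cocomm : IsCommComonObj X
  frob_left : comon.comul ▷ X ≫ (α_ X X X).hom ≫ X ◁ mon.mul = mon.mul ≫ comon.comul
  frob_right : X ◁ comon.comul ≫ (α_ X X X).inv ≫ mon.mul ▷ X = mon.mul ≫ comon.comul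
  separable : comon.comul ≫ mon.mul = 𝟙 X

namespace FrobeniusObj

variable {A : Type u} [Category.{v} A] [MonoidalCategory A] [SymmetricCategory A]

/-- The trivial Frobenius structure on the monoidal unit. -/
def unit (A : Type u) [Category.{v} A] [MonoidalCategory A] [SymmetricCategory A] :
    FrobeniusObj (𝟙_ A) where
  mon := inferInstance
  comon := ComonObj.instTensorUnit A
  comm := inferInstance
  cocomm := CommComon.instCommComonObjUnit
  frob_left := by
    change (λ_ (𝟙_ A)).inv ▷ _ ≫ _ ≫ _ ◁ (λ_ (𝟙_ A)).hom = (λ_ (𝟙_ A)).hom ≫ (λ_ (𝟙_ A)).inv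
    monoidal
  frob_right := by
    change _ ◁ (λ_ (𝟙_ A)).inv ≫ _ ≫ (λ_ (𝟙_ A)).hom ▷ _ = (λ_ (𝟙_ A)).hom ≫ (λ_ (𝟙_ A)).inv
    monoidal
  separable := (λ_ (𝟙_ A)).inv_hom_id

/-- A symmetry is its own inverse, so exchanging the middle two factors twice does nothing. This
fails for a general braiding, where `tensorδ` uses the inverse crossing. -/
theorem tensorμ_tensorμ_symm (X₁ X₂ Y₁ Y₂ : A) :
    tensorμ X₁ X₂ Y₁ Y₂ ≫ tensorμ X₁ Y₁ X₂ Y₂ = 𝟙 _ := by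
  have : tensorμ X₁ Y₁ X₂ Y₂ = tensorδ X₁ X₂ Y₁ Y₂ := by
    simp [tensorμ, tensorδ, SymmetricCategory.braiding_swap_eq_inv_braiding X₂ Y₁]
  rw [this, tensorμ_tensorδ]

/-- Conjugating by the middle interchange turns the law on `X ⊗ Y` into the tensor of the laws on
`X` and `Y`. The interchanges around the associator are rearranged by `key`; naturality then moves
`d ⊗ₘ e` and `m ⊗ₘ n` past them. -/
theorem frob_left_tensor {X Y : A} (m : X ⊗ X ⟶ X) (d : X ⟶ X ⊗ X) (n : Y ⊗ Y ⟶ Y)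
    (e : Y ⟶ Y ⊗ Y) (hX : d ▷ X ≫ (α_ X X X).hom ≫ X ◁ m = m ≫ d)
    (hY : e ▷ Y ≫ (α_ Y Y Y).hom ≫ Y ◁ n = n ≫ e) :
    ((d ⊗ₘ e) ≫ tensorμ X X Y Y) ▷ (X ⊗ Y) ≫ (α_ (X ⊗ Y) (X ⊗ Y) (X ⊗ Y)).hom ≫
      (X ⊗ Y) ◁ (tensorμ X Y X Y ≫ (m ⊗ₘ n)) =
      (tensorμ X Y X Y ≫ (m ⊗ₘ n)) ≫ (d ⊗ₘ e) ≫ tensorμ X X Y Y := by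
  have h := tensor_associativity X Y X Y X Y
  have key : tensorμ X X Y Y ▷ (X ⊗ Y) ≫ (α_ (X ⊗ Y) (X ⊗ Y) (X ⊗ Y)).hom ≫
      (X ⊗ Y) ◁ tensorμ X Y X Y =
      tensorμ (X ⊗ X) (Y ⊗ Y) X Y ≫ ((α_ X X X).hom ⊗ₘ (α_ Y Y Y).hom) ≫
        tensorμ X (X ⊗ X) Y (Y ⊗ Y) := by
    -- Both outer factors are inverse to interchanges in `h`, so composing with them solves `h` for
    -- the left side of `key`.
    have h' := congrArg (fun t => tensorμ X X Y Y ▷ (X ⊗ Y) ≫ t ≫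
      tensorμ X (X ⊗ X) Y (Y ⊗ Y)) h
    simp only [Category.assoc, tensorμ_tensorμ_symm, Category.comp_id] at h'
    rw [← h', ← comp_whiskerRight_assoc, tensorμ_tensorμ_symm, id_whiskerRight, Category.id_comp]
  have nat : tensorμ X (X ⊗ X) Y (Y ⊗ Y) ≫ (X ⊗ Y) ◁ (m ⊗ₘ n) =
      (X ◁ m ⊗ₘ Y ◁ n) ≫ tensorμ X X Y Y := by
    simpa using (tensorμ_natural (𝟙 X) m (𝟙 Y) n).symm
  simp only [comp_whiskerRight, MonoidalCategory.whiskerLeft_comp, Category.assoc]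
  rw [reassoc_of% key, tensorμ_natural_left_assoc, nat]
  simp only [tensorHom_comp_tensorHom_assoc, hX, hY]

/-- The mirror argument: here the associativity coherence is solved for the interchange standing
after the inverse associator. -/
theorem frob_right_tensor {X Y : A} (m : X ⊗ X ⟶ X) (d : X ⟶ X ⊗ X) (n : Y ⊗ Y ⟶ Y)
    (e : Y ⟶ Y ⊗ Y) (hX : X ◁ d ≫ (α_ X X X).inv ≫ m ▷ X = m ≫ d)
    (hY : Y ◁ e ≫ (α_ Y Y Y).inv ≫ n ▷ Y = n ≫ e) :
    (X ⊗ Y) ◁ ((d ⊗ₘ e) ≫ tensorμ X X Y Y) ≫ (α_ (X ⊗ Y) (X ⊗ Y) (X ⊗ Y)).inv ≫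
      (tensorμ X Y X Y ≫ (m ⊗ₘ n)) ▷ (X ⊗ Y) =
      (tensorμ X Y X Y ≫ (m ⊗ₘ n)) ≫ (d ⊗ₘ e) ≫ tensorμ X X Y Y := by
  have h := tensor_associativity X Y X Y X Y
  have key : (X ⊗ Y) ◁ tensorμ X X Y Y ≫ (α_ (X ⊗ Y) (X ⊗ Y) (X ⊗ Y)).inv ≫
      tensorμ X Y X Y ▷ (X ⊗ Y) =
      tensorμ X Y (X ⊗ X) (Y ⊗ Y) ≫ ((α_ X X X).inv ⊗ₘ (α_ Y Y Y).inv) ≫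
        tensorμ (X ⊗ X) X (Y ⊗ Y) Y := by
    have h' := congrArg (fun t => (X ⊗ Y) ◁ tensorμ X X Y Y ≫
      (α_ (X ⊗ Y) (X ⊗ Y) (X ⊗ Y)).inv ≫ t ≫ ((α_ X X X).inv ⊗ₘ (α_ Y Y Y).inv) ≫
      tensorμ (X ⊗ X) X (Y ⊗ Y) Y) h
    simp only [Category.assoc, tensorHom_comp_tensorHom_assoc, Iso.hom_inv_id,
      id_tensorHom_id, Category.id_comp, tensorμ_tensorμ_symm, Category.comp_id,
      Iso.inv_hom_id_assoc] at h'
    rw [h', ← MonoidalCategory.whiskerLeft_comp_assoc, tensorμ_tensorμ_symm,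
      MonoidalCategory.whiskerLeft_id, Category.id_comp]
  have nat : tensorμ (X ⊗ X) X (Y ⊗ Y) Y ≫ (m ⊗ₘ n) ▷ (X ⊗ Y) =
      (m ▷ X ⊗ₘ n ▷ Y) ≫ tensorμ X X Y Y := by
    simpa using (tensorμ_natural m (𝟙 X) n (𝟙 Y)).symm
  simp only [comp_whiskerRight, MonoidalCategory.whiskerLeft_comp, Category.assoc]
  rw [reassoc_of% key, tensorμ_natural_right_assoc, nat]
  simp only [tensorHom_comp_tensorHom_assoc, hX, hY]

/-- The Frobenius structure on a tensor product. -/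
def tensor {X Y : A} (f : FrobeniusObj X) (g : FrobeniusObj Y) : FrobeniusObj (X ⊗ Y) :=
  letI := f.mon
  letI := g.mon
  letI := f.comon
  letI := g.comon
  letI := f.comm
  letI := g.comm
  letI := f.cocomm
  letI := g.cocomm
  { mon := inferInstance
    comon := inferInstance
    comm := inferInstance
    cocomm := inferInstance
    frob_left := by
      rw [Comon.tensorObj_comul, MonObj.tensorObj.mul_def]
      exact frob_left_tensor _ _ _ _ f.frob_left g.frob_left
    frob_right := by
      rw [Comon.tensorObj_comul, MonObj.tensorObj.mul_def]
      exact frob_right_tensor _ _ _ _ f.frob_right g.frob_right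
    separable := by
      rw [Comon.tensorObj_comul, MonObj.tensorObj.mul_def]
      simp only [Category.assoc]
      rw [← Category.assoc (tensorμ _ _ _ _), tensorμ_tensorμ_symm, Category.id_comp,
        tensorHom_comp_tensorHom, f.separable, g.separable, id_tensorHom_id] }

theorem tensor_mul {X Y : A} (f : FrobeniusObj X) (g : FrobeniusObj Y) :
    (f.tensor g).mon.mul = tensorμ X Y X Y ≫ (f.mon.mul ⊗ₘ g.mon.mul) := rfl

theorem tensor_one {X Y : A} (f : FrobeniusObj X) (g : FrobeniusObj Y) :
    (f.tensor g).mon.one = (λ_ (𝟙_ A)).inv ≫ (f.mon.one ⊗ₘ g.mon.one) := rfl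

theorem tensor_comul {X Y : A} (f : FrobeniusObj X) (g : FrobeniusObj Y) :
    (f.tensor g).comon.comul = (f.comon.comul ⊗ₘ g.comon.comul) ≫ tensorμ X X Y Y :=
  @Comon.tensorObj_comul _ _ _ _ X Y f.comon g.comon

theorem tensor_counit {X Y : A} (f : FrobeniusObj X) (g : FrobeniusObj Y) :
    (f.tensor g).comon.counit =
      (f.comon.counit ⊗ₘ g.comon.counit) ≫ (λ_ (𝟙_ A)).hom := rfl

/-! ### Coherence isomorphisms preserve the Frobenius operations -/

/-- The coherence isomorphisms of bundled comonoids carry whiskered identities around the underlying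
one. Removing these lets the comonoid halves of the coherence lemmas be read off from morphisms in
`Comon A`. -/
theorem comon_associator_hom (X Y Z : Comon A) :
    (α_ X Y Z).hom.hom = (α_ X.X Y.X Z.X).hom := by
  rw [Comon.monoidal_associator_hom_hom]
  change 𝟙 (X.X ⊗ Y.X) ▷ Z.X ≫ (α_ X.X Y.X Z.X).hom ≫ X.X ◁ 𝟙 (Y.X ⊗ Z.X) = _
  simp

theorem comon_leftUnitor_hom (X : Comon A) : (λ_ X).hom.hom = (λ_ X.X).hom := by
  rw [Comon.monoidal_leftUnitor_hom_hom]
  change 𝟙 (𝟙_ A) ▷ X.X ≫ (λ_ X.X).hom = _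
  simp

theorem comon_rightUnitor_hom (X : Comon A) : (ρ_ X).hom.hom = (ρ_ X.X).hom := by
  rw [Comon.monoidal_rightUnitor_hom_hom]
  change X.X ◁ 𝟙 (𝟙_ A) ≫ (ρ_ X.X).hom = _
  simp

/-- The associator is a morphism of monoids. In a prop, where it can reduce to an identity, this and
its three companions become an equality of structures. -/
theorem tensor_assoc_mul {X Y Z : A} (f : FrobeniusObj X) (g : FrobeniusObj Y)
    (h : FrobeniusObj Z) :
    ((f.tensor g).tensor h).mon.mul ≫ (α_ X Y Z).hom =
      ((α_ X Y Z).hom ⊗ₘ (α_ X Y Z).hom) ≫ (f.tensor (g.tensor h)).mon.mul :=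
  letI := f.mon
  letI := g.mon
  letI := h.mon
  IsMonHom.mul_hom (α_ X Y Z).hom

theorem tensor_assoc_one {X Y Z : A} (f : FrobeniusObj X) (g : FrobeniusObj Y)
    (h : FrobeniusObj Z) :
    ((f.tensor g).tensor h).mon.one ≫ (α_ X Y Z).hom = (f.tensor (g.tensor h)).mon.one :=
  letI := f.mon
  letI := g.mon
  letI := h.mon
  IsMonHom.one_hom (α_ X Y Z).hom

theorem tensor_assoc_comul {X Y Z : A} (f : FrobeniusObj X) (g : FrobeniusObj Y)
    (h : FrobeniusObj Z) :
    (α_ X Y Z).hom ≫ (f.tensor (g.tensor h)).comon.comul =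
      ((f.tensor g).tensor h).comon.comul ≫ ((α_ X Y Z).hom ⊗ₘ (α_ X Y Z).hom) := by
  let := f.comon
  let := g.comon
  let := h.comon
  have e := IsComonHom.hom_comul (α_ (Comon.mk X) (Comon.mk Y) (Comon.mk Z)).hom.hom
  rw [comon_associator_hom] at e
  exact e

theorem tensor_assoc_counit {X Y Z : A} (f : FrobeniusObj X) (g : FrobeniusObj Y)
    (h : FrobeniusObj Z) :
    (α_ X Y Z).hom ≫ (f.tensor (g.tensor h)).comon.counit =
      ((f.tensor g).tensor h).comon.counit := by
  let := f.comon
  let := g.comon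
  let := h.comon
  have e := IsComonHom.hom_counit (α_ (Comon.mk X) (Comon.mk Y) (Comon.mk Z)).hom.hom
  rw [comon_associator_hom] at e
  exact e

theorem unit_tensor_mul {X : A} (f : FrobeniusObj X) :
    ((unit A).tensor f).mon.mul ≫ (λ_ X).hom =
      ((λ_ X).hom ⊗ₘ (λ_ X).hom) ≫ f.mon.mul :=
  letI := f.mon
  IsMonHom.mul_hom (λ_ X).hom

theorem unit_tensor_one {X : A} (f : FrobeniusObj X) :
    ((unit A).tensor f).mon.one ≫ (λ_ X).hom = f.mon.one :=
  letI := f.mon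
  IsMonHom.one_hom (λ_ X).hom

theorem unit_tensor_comul {X : A} (f : FrobeniusObj X) :
    (λ_ X).hom ≫ f.comon.comul =
      ((unit A).tensor f).comon.comul ≫ ((λ_ X).hom ⊗ₘ (λ_ X).hom) := by
  let := f.comon
  have e := IsComonHom.hom_comul (λ_ (Comon.mk X)).hom.hom
  rw [comon_leftUnitor_hom] at e
  exact e

theorem unit_tensor_counit {X : A} (f : FrobeniusObj X) :
    (λ_ X).hom ≫ f.comon.counit = ((unit A).tensor f).comon.counit := by
  let := f.comon
  have e := IsComonHom.hom_counit (λ_ (Comon.mk X)).hom.hom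
  rw [comon_leftUnitor_hom] at e
  exact e

theorem tensor_unit_mul {X : A} (f : FrobeniusObj X) :
    (f.tensor (unit A)).mon.mul ≫ (ρ_ X).hom =
      ((ρ_ X).hom ⊗ₘ (ρ_ X).hom) ≫ f.mon.mul :=
  letI := f.mon
  IsMonHom.mul_hom (ρ_ X).hom

theorem tensor_unit_one {X : A} (f : FrobeniusObj X) :
    (f.tensor (unit A)).mon.one ≫ (ρ_ X).hom = f.mon.one :=
  letI := f.mon
  IsMonHom.one_hom (ρ_ X).hom

theorem tensor_unit_comul {X : A} (f : FrobeniusObj X) :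
    (ρ_ X).hom ≫ f.comon.comul =
      (f.tensor (unit A)).comon.comul ≫ ((ρ_ X).hom ⊗ₘ (ρ_ X).hom) := by
  let := f.comon
  have e := IsComonHom.hom_comul (ρ_ (Comon.mk X)).hom.hom
  rw [comon_rightUnitor_hom] at e
  exact e

theorem tensor_unit_counit {X : A} (f : FrobeniusObj X) :
    (ρ_ X).hom ≫ f.comon.counit = (f.tensor (unit A)).comon.counit := by
  let := f.comon
  have e := IsComonHom.hom_counit (ρ_ (Comon.mk X)).hom.hom
  rw [comon_rightUnitor_hom] at e
  exact e

/-- The hypotheses have the shape of the coherence lemmas with the isomorphism replaced by `𝟙 X`, so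
those lemmas apply verbatim when it reduces to an identity. The remaining fields are propositions,
so the four operations decide equality. -/
theorem eq_of_id {X : A} {f g : FrobeniusObj X}
    (h₁ : f.mon.mul ≫ 𝟙 X = (𝟙 X ⊗ₘ 𝟙 X) ≫ g.mon.mul) (h₂ : f.mon.one ≫ 𝟙 X = g.mon.one)
    (h₃ : 𝟙 X ≫ g.comon.comul = f.comon.comul ≫ (𝟙 X ⊗ₘ 𝟙 X))
    (h₄ : 𝟙 X ≫ g.comon.counit = f.comon.counit) : f = g := by
  obtain ⟨⟨_, _⟩, ⟨_, _⟩⟩ := f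
  obtain ⟨⟨_, _⟩, ⟨_, _⟩⟩ := g
  simp only [Category.comp_id, Category.id_comp, id_tensorHom_id] at h₁ h₂ h₃ h₄
  cases h₁
  cases h₂
  cases h₃
  cases h₄
  rfl

end FrobeniusObj

/-- The Frobenius structure carried by an object of a hypergraph category. -/
def HypergraphCategory.frobeniusObj {A : Type u} [Category.{v} A] [MonoidalCategory A]
    [SymmetricCategory A] (h : HypergraphCategory A) (X : A) : FrobeniusObj X where
  mon := h.monObj X
  comon := h.comonObj X
  comm := h.isCommMonObj X
  cocomm := h.isCommComonObj X
  frob_left := h.frob_left X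
  frob_right := h.frob_right X
  separable := h.separable X

/-! ### From Frobenius structures on letters to hypergraph structures -/

namespace ColouredProp

variable {C : Type u}

/-- A colour, as an object of a prop. -/
def colour (P : ColouredProp C) (c : C) : P.Obj := ([c] : List C)

/-- The Frobenius structure on a word, obtained from Frobenius structures on its letters. -/
def wordFrobenius (P : ColouredProp C) (f : ∀ c : C, FrobeniusObj (P.colour c)) :
    ∀ w : List C, FrobeniusObj (A := P.Obj) w
  | [] => FrobeniusObj.unit P.Obj
  | c :: w => FrobeniusObj.tensor (X := P.colour c) (f c) (P.wordFrobenius f w)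

/-- The recursion gives `f c` tensored with the trivial structure on the empty word, and the right
unitor at a single letter reduces to an identity. -/
theorem wordFrobenius_singleton (P : ColouredProp C)
    (f : ∀ c : C, FrobeniusObj (P.colour c)) (c : C) : P.wordFrobenius f [c] = f c :=
  FrobeniusObj.eq_of_id (f c).tensor_unit_mul (f c).tensor_unit_one (f c).tensor_unit_comul
    (f c).tensor_unit_counit

/-- The first factor is a single letter because then both bracketings are the same word by reduction
and the associator is an identity. For an arbitrary first word the two sides would have different
types. -/
theorem tensor_assoc_colour (P : ColouredProp C) {c : C} {w v : P.Obj}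
    (f : FrobeniusObj (P.colour c)) (g : FrobeniusObj w) (h : FrobeniusObj v) :
    (f.tensor g).tensor h = f.tensor (g.tensor h) :=
  FrobeniusObj.eq_of_id (f.tensor_assoc_mul g h) (f.tensor_assoc_one g h)
    (f.tensor_assoc_comul g h) (f.tensor_assoc_counit g h)

theorem unit_tensor_frobenius (P : ColouredProp C) {w : P.Obj} (f : FrobeniusObj w) :
    (FrobeniusObj.unit P.Obj).tensor f = f :=
  FrobeniusObj.eq_of_id f.unit_tensor_mul f.unit_tensor_one f.unit_tensor_comul
    f.unit_tensor_counit

/-- Induction on the first word peels off one letter at a time, so only the definitional cases of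
associativity and left unitality are needed. -/
theorem wordFrobenius_append (P : ColouredProp C)
    (f : ∀ c : C, FrobeniusObj (P.colour c)) (w v : P.Obj) :
    P.wordFrobenius f (w ⊗ v : P.Obj) = (P.wordFrobenius f w).tensor (P.wordFrobenius f v) := by
  induction w with
  | nil => exact (P.unit_tensor_frobenius _).symm
  | cons c w ih =>
    exact (congrArg (FrobeniusObj.tensor (f c)) ih).trans
      (P.tensor_assoc_colour (f c) (P.wordFrobenius f w) (P.wordFrobenius f v)).symm

/-- The hypergraph structure on a prop determined by Frobenius structures on its colours. -/
@[reducible]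
def hypergraphOfFrobenius (P : ColouredProp C)
    (f : ∀ c : C, FrobeniusObj (P.colour c)) : HypergraphCategory P.Obj where
  monObj w := (P.wordFrobenius f w).mon
  comonObj w := (P.wordFrobenius f w).comon
  isCommMonObj w := (P.wordFrobenius f w).comm
  isCommComonObj w := (P.wordFrobenius f w).cocomm
  frob_left w := (P.wordFrobenius f w).frob_left
  frob_right w := (P.wordFrobenius f w).frob_right
  separable w := (P.wordFrobenius f w).separable
  mul_tensor w v := by rw [wordFrobenius_append, FrobeniusObj.tensor_mul]
  one_tensor w v := by rw [wordFrobenius_append, FrobeniusObj.tensor_one]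
  comul_tensor w v := by rw [wordFrobenius_append, FrobeniusObj.tensor_comul]
  counit_tensor w v := by rw [wordFrobenius_append, FrobeniusObj.tensor_counit]

/-! ### Models of the theory of separable Frobenius monoids -/

section

variable {P : ColouredProp C} (φ : ∀ o : FrobOp C, P.Hom o.arity o.coarity) (c : C)

/-- The interpretation of the multiplication. -/
def frobMul : P.Hom [c, c] [c] := φ (.mul c)

/-- The interpretation of the unit. -/
def frobOne : P.Hom [] [c] := φ (.one c)

/-- The interpretation of the comultiplication. -/
def frobComul : P.Hom [c] [c, c] := φ (.comul c)

/-- The interpretation of the counit. -/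
def frobCounit : P.Hom [c] [] := φ (.counit c)

end

/-- The interpretation `φ` of the Frobenius operations in `P` satisfies the equations of separable
Frobenius monoids. -/
structure IsFrobModel (P : ColouredProp C) (φ : ∀ o : FrobOp C, P.Hom o.arity o.coarity) :
    Prop where
  mul_comm : ∀ c, P.comp (P.sym [c] [c]) (frobMul φ c) = frobMul φ c
  one_mul : ∀ c, P.comp (P.tensor (frobOne φ c) (P.id [c])) (frobMul φ c) = P.id [c]
  mul_assoc : ∀ c, P.comp (P.tensor (frobMul φ c) (P.id [c])) (frobMul φ c) =
    P.comp (P.tensor (P.id [c]) (frobMul φ c)) (frobMul φ c)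
  comul_comm : ∀ c, P.comp (frobComul φ c) (P.sym [c] [c]) = frobComul φ c
  counit_comul : ∀ c, P.comp (frobComul φ c) (P.tensor (frobCounit φ c) (P.id [c])) = P.id [c]
  comul_assoc : ∀ c, P.comp (frobComul φ c) (P.tensor (frobComul φ c) (P.id [c])) =
    P.comp (frobComul φ c) (P.tensor (P.id [c]) (frobComul φ c))
  frob_left : ∀ c, P.comp (v := [c, c, c]) (z := [c, c])
    (P.tensor (frobComul φ c) (P.id [c])) (P.tensor (P.id [c]) (frobMul φ c)) =
    P.comp (frobMul φ c) (frobComul φ c)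
  frob_right : ∀ c, P.comp (v := [c, c, c]) (z := [c, c])
    (P.tensor (P.id [c]) (frobComul φ c)) (P.tensor (frobMul φ c) (P.id [c])) =
    P.comp (frobMul φ c) (frobComul φ c)
  separable : ∀ c, P.comp (frobComul φ c) (frobMul φ c) = P.id [c]

/-- The Frobenius structure on a colour given by a model. -/
def IsFrobModel.frobeniusObj {P : ColouredProp C} {φ : ∀ o : FrobOp C, P.Hom o.arity o.coarity}
    (h : P.IsFrobModel φ) (c : C) : FrobeniusObj (P.colour c) :=
  let X : P.Obj := P.colour c
  let m : X ⊗ X ⟶ X := φ (.mul c)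
  let e : 𝟙_ P.Obj ⟶ X := φ (.one c)
  let d : X ⟶ X ⊗ X := φ (.comul c)
  let k : X ⟶ 𝟙_ P.Obj := φ (.counit c)
  -- The left unitor, and the associator at letters, are identities by reduction, so the strict
  -- equations of the model serve directly as monoidal ones.
  have mul_comm : (β_ X X).hom ≫ m = m := h.mul_comm c
  have one_mul : e ▷ X ≫ m = (λ_ X).hom := h.one_mul c
  have comul_comm : d ≫ (β_ X X).hom = d := h.comul_comm c
  have counit_comul : d ≫ k ▷ X = (λ_ X).inv := h.counit_comul c
  { mon :=
      { mul := m
        one := e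
        one_mul := one_mul
        mul_one := by
          -- Only left unitality is among the equations; commutativity yields the right unit law,
          -- and dually the right counit law below.
          rw [← mul_comm, BraidedCategory.braiding_naturality_right_assoc, one_mul,
            braiding_leftUnitor]
        -- The only discrepancy with the strict law is composition with an associator that reduces
        -- to an identity; the same holds for coassociativity and the Frobenius laws.
        mul_assoc := (h.mul_assoc c).trans (Category.id_comp (X ◁ m ≫ m)).symm }
    comon :=
      { comul := d
        counit := k
        counit_comul := counit_comul
        comul_counit := by
          rw [← comul_comm, Category.assoc, ← BraidedCategory.braiding_naturality_left,
            reassoc_of% counit_comul, leftUnitor_inv_braiding]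
        comul_assoc := (h.comul_assoc c).symm.trans
          (congrArg (fun t => d ≫ t) (Category.comp_id (d ▷ X)).symm) }
    comm := @IsCommMonObj.mk _ _ _ _ _ (_) mul_comm
    cocomm := @IsCommComonObj.mk _ _ _ _ _ (_) comul_comm
    frob_left :=
      (congrArg (fun t => d ▷ X ≫ t) (Category.id_comp (X ◁ m))).trans (h.frob_left c)
    frob_right :=
      (congrArg (fun t => X ◁ d ≫ t) (Category.id_comp (m ▷ X))).trans (h.frob_right c)
    separable := h.separable c }

/-- The Frobenius operations of a hypergraph structure on a prop. -/
def frobOps (P : ColouredProp C) (hP : HypergraphCategory P.Obj) :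
    ∀ o : FrobOp C, P.Hom o.arity o.coarity
  | .mul c => P.mulHom hP [c]
  | .one c => P.oneHom hP [c]
  | .comul c => P.comulHom hP [c]
  | .counit c => P.counitHom hP [c]

theorem isFrobModel_frobOps (P : ColouredProp C) (hP : HypergraphCategory P.Obj) :
    P.IsFrobModel (P.frobOps hP) where
  mul_comm c := (hP.isCommMonObj (P.colour c)).mul_comm
  one_mul c := (hP.monObj (P.colour c)).one_mul
  mul_assoc c := (hP.monObj (P.colour c)).mul_assoc.trans
    (Category.id_comp (P.colour c ◁ (hP.monObj (P.colour c)).mul ≫ (hP.monObj (P.colour c)).mul))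
  comul_comm c := (hP.isCommComonObj (P.colour c)).comul_comm
  counit_comul c := (hP.comonObj (P.colour c)).counit_comul
  comul_assoc c := ((hP.comonObj (P.colour c)).comul_assoc.trans
    (congrArg (fun t => (hP.comonObj (P.colour c)).comul ≫ t)
      (Category.comp_id ((hP.comonObj (P.colour c)).comul ▷ P.colour c)))).symm
  frob_left c := (congrArg (fun t => (hP.comonObj (P.colour c)).comul ▷ P.colour c ≫ t)
    (Category.id_comp (P.colour c ◁ (hP.monObj (P.colour c)).mul))).symm.trans
    (hP.frob_left (P.colour c))
  frob_right c := (congrArg (fun t => P.colour c ◁ (hP.comonObj (P.colour c)).comul ≫ t)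
    (Category.id_comp ((hP.monObj (P.colour c)).mul ▷ P.colour c))).symm.trans
    (hP.frob_right (P.colour c))
  separable c := hP.separable (P.colour c)

theorem extendsFrob_hypergraphOfFrobenius {P : ColouredProp C}
    {φ : ∀ o : FrobOp C, P.Hom o.arity o.coarity} (h : P.IsFrobModel φ) :
    ExtendsFrob (P.hypergraphOfFrobenius h.frobeniusObj) φ where
  mul c := congrArg (fun f => f.mon.mul) (P.wordFrobenius_singleton h.frobeniusObj c)
  one c := congrArg (fun f => f.mon.one) (P.wordFrobenius_singleton h.frobeniusObj c)
  comul c := congrArg (fun f => f.comon.comul) (P.wordFrobenius_singleton h.frobeniusObj c)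
  counit c := congrArg (fun f => f.comon.counit) (P.wordFrobenius_singleton h.frobeniusObj c)

end ColouredProp

namespace ColouredProp

variable {C : Type u} {P Q : ColouredProp C}

/-! ### Morphisms of props and hypergraph structures -/

/-- Used as a term rather than a rewrite, so that intermediate words need only agree up to
reduction, such as `[c] ++ [c]` and `[c, c]`. -/
theorem Mor.map_comp_eq (F : Mor P Q) {w v z : List C} {f : P.Hom w v} {g : P.Hom v z}
    {f' : Q.Hom w v} {g' : Q.Hom v z} (hf : F.map f = f') (hg : F.map g = g') :
    F.map (P.comp f g) = Q.comp f' g' := by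
  rw [F.map_comp, hf, hg]

theorem Mor.map_tensor_eq (F : Mor P Q) {w v w' v' : List C} {f : P.Hom w v} {g : P.Hom w' v'}
    {f' : Q.Hom w v} {g' : Q.Hom w' v'} (hf : F.map f = f') (hg : F.map g = g') :
    F.map (P.tensor f g) = Q.tensor f' g' := by
  rw [F.map_tensor, hf, hg]

theorem Mor.map_eqToHom (F : Mor P Q) {w v : List C} (h : w = v) :
    F.map (eqToHom (C := P.Obj) h) = eqToHom (C := Q.Obj) h := by
  subst h
  exact F.map_id w

/-- The interchange is assembled from associators, which are transports along equalities of words,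
and one symmetry; a prop morphism preserves each. -/
theorem Mor.map_tensorμ (F : Mor P Q) (w v x y : List C) :
    F.map (tensorμ (C := P.Obj) w v x y) = tensorμ (C := Q.Obj) w v x y :=
  F.map_comp_eq (F.map_eqToHom (List.append_assoc w v (x ++ y))) <|
    F.map_comp_eq (F.map_tensor_eq (F.map_id _) (F.map_eqToHom (List.append_assoc v x y).symm)) <|
      F.map_comp_eq (F.map_tensor_eq (F.map_id _) (F.map_tensor_eq (F.map_sym _ _) (F.map_id _))) <|
        F.map_comp_eq (F.map_tensor_eq (F.map_id _) (F.map_eqToHom (List.append_assoc x v y)))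
          (F.map_eqToHom (List.append_assoc w x (v ++ y)).symm)

/-- No axiom names the structure on the empty word, but compatibility with ε = ε ⊗ ε makes its unit
η idempotent, because tensor and composition agree on endomorphisms of ε. The unit law gives η;μ =
id, so η = η;η;μ = η;μ = id. -/
theorem oneHom_nil (hP : HypergraphCategory P.Obj) : P.oneHom hP [] = P.id [] := by
  have h₁ : P.oneHom hP [] = P.comp (P.id []) (P.tensor (P.oneHom hP []) (P.oneHom hP [])) :=
    hP.one_tensor ([] : List C) ([] : List C)
  have h₂ : P.comp (P.tensor (P.oneHom hP []) (P.id [])) (P.mulHom hP []) = P.id [] :=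
    (hP.monObj ([] : List C)).one_mul
  have h₃ : P.tensor (P.oneHom hP []) (P.id []) = P.oneHom hP [] := P.tensor_unit (P.oneHom hP [])
  have h₄ : P.tensor (P.oneHom hP []) (P.oneHom hP []) =
      P.comp (P.oneHom hP []) (P.oneHom hP []) := by
    have := P.tensor_comp (P.oneHom hP []) (P.id []) (P.id []) (P.oneHom hP [])
    rw [P.comp_id, P.id_comp, h₃, P.unit_tensor] at this
    exact this
  rw [P.id_comp, h₄] at h₁
  rw [h₃] at h₂
  calc P.oneHom hP [] = P.comp (P.oneHom hP []) (P.id []) := (P.comp_id _).symm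
    _ = P.comp (P.comp (P.oneHom hP []) (P.oneHom hP [])) (P.mulHom hP []) := by
      rw [P.assoc, h₂]
    _ = P.id [] := by rw [← h₁, h₂]

theorem mulHom_nil (hP : HypergraphCategory P.Obj) : P.mulHom hP [] = P.id [] := by
  have h₂ : P.comp (P.tensor (P.oneHom hP []) (P.id [])) (P.mulHom hP []) = P.id [] :=
    (hP.monObj ([] : List C)).one_mul
  rw [oneHom_nil, P.tensor_id] at h₂
  exact (P.id_comp _).symm.trans h₂

/-- Dually, the counit is idempotent and has the comultiplication as a section, hence is the
identity. -/
theorem counitHom_nil (hP : HypergraphCategory P.Obj) : P.counitHom hP [] = P.id [] := by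
  have h₁ : P.counitHom hP [] =
      P.comp (P.tensor (P.counitHom hP []) (P.counitHom hP [])) (P.id []) :=
    hP.counit_tensor ([] : List C) ([] : List C)
  have h₂ : P.comp (P.comulHom hP []) (P.tensor (P.counitHom hP []) (P.id [])) = P.id [] :=
    (hP.comonObj ([] : List C)).counit_comul
  have h₃ : P.tensor (P.counitHom hP []) (P.id []) = P.counitHom hP [] := P.tensor_unit (P.counitHom hP [])
  have h₄ : P.tensor (P.counitHom hP []) (P.counitHom hP []) =
      P.comp (P.counitHom hP []) (P.counitHom hP []) := by
    have := P.tensor_comp (P.counitHom hP []) (P.id []) (P.id []) (P.counitHom hP [])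
    rw [P.comp_id, P.id_comp, h₃, P.unit_tensor] at this
    exact this
  have h₅ : P.counitHom hP [] = P.comp (P.counitHom hP []) (P.counitHom hP []) :=
    h₁.trans ((P.comp_id _).trans h₄)
  rw [h₃] at h₂
  calc P.counitHom hP [] = P.comp (P.id []) (P.counitHom hP []) := (P.id_comp _).symm
    _ = P.comp (P.comulHom hP []) (P.comp (P.counitHom hP []) (P.counitHom hP [])) := by
      rw [← P.assoc, h₂]
    _ = P.id [] := by rw [← h₅, h₂]

theorem comulHom_nil (hP : HypergraphCategory P.Obj) : P.comulHom hP [] = P.id [] := by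
  have h₂ : P.comp (P.comulHom hP []) (P.tensor (P.counitHom hP []) (P.id [])) = P.id [] :=
    (hP.comonObj ([] : List C)).counit_comul
  rw [counitHom_nil, P.tensor_id] at h₂
  exact (P.comp_id _).symm.trans h₂

/-- A morphism of props that preserves the Frobenius structure on colours preserves it on all
words. -/
theorem isHypergraphMor_of_frobOps (hP : HypergraphCategory P.Obj) (hQ : HypergraphCategory Q.Obj)
    (F : Mor P Q) (h : ∀ o, F.map (P.frobOps hP o) = Q.frobOps hQ o) :
    IsHypergraphMor hP hQ F where
  map_mul w := by
    induction w with
    | nil => rw [mulHom_nil, mulHom_nil]; exact F.map_id []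
    | cons c w ih =>
      -- The word `c :: w` is `[c] ⊗ w` by reduction, so `mul_tensor` expresses its multiplication
      -- through those of `[c]` and `w`. The other three operations follow the same pattern.
      have e := F.map_comp_eq (F.map_tensorμ [c] w [c] w) (F.map_tensor_eq (h (.mul c)) ih)
      exact (congrArg F.map (hP.mul_tensor (P.colour c) w)).trans
        (e.trans (hQ.mul_tensor (Q.colour c) w).symm)
  map_one w := by
    induction w with
    | nil => rw [oneHom_nil, oneHom_nil]; exact F.map_id []
    | cons c w ih =>
      have e := F.map_comp_eq (F.map_id []) (F.map_tensor_eq (h (.one c)) ih)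
      exact (congrArg F.map (hP.one_tensor (P.colour c) w)).trans
        (e.trans (hQ.one_tensor (Q.colour c) w).symm)
  map_comul w := by
    induction w with
    | nil => rw [comulHom_nil, comulHom_nil]; exact F.map_id []
    | cons c w ih =>
      have e := F.map_comp_eq (F.map_tensor_eq (h (.comul c)) ih) (F.map_tensorμ [c] [c] w w)
      exact (congrArg F.map (hP.comul_tensor (P.colour c) w)).trans
        (e.trans (hQ.comul_tensor (Q.colour c) w).symm)
  map_counit w := by
    induction w with
    | nil => rw [counitHom_nil, counitHom_nil]; exact F.map_id []
    | cons c w ih =>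
      have e := F.map_comp_eq (F.map_tensor_eq (h (.counit c)) ih) (F.map_id [])
      exact (congrArg F.map (hP.counit_tensor (P.colour c) w)).trans
        (e.trans (hQ.counit_tensor (Q.colour c) w).symm)

theorem frobOps_eq_of_extendsFrob {hP : HypergraphCategory P.Obj}
    {φ : ∀ o : FrobOp C, P.Hom o.arity o.coarity} (h : ExtendsFrob hP φ) : P.frobOps hP = φ := by
  funext o
  cases o with
  | mul c => exact h.mul c
  | one c => exact h.one c
  | comul c => exact h.comul c
  | counit c => exact h.counit c

theorem map_frobOps_of_isHypergraphMor {hP : HypergraphCategory P.Obj}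
    {hQ : HypergraphCategory Q.Obj} {F : Mor P Q} (h : IsHypergraphMor hP hQ F) (o : FrobOp C) :
    F.map (P.frobOps hP o) = Q.frobOps hQ o := by
  cases o with
  | mul c => exact h.map_mul [c]
  | one c => exact h.map_one [c]
  | comul c => exact h.map_comul [c]
  | counit c => exact h.map_counit [c]

end ColouredProp

/-! ### The universal property of presented props -/

section Presented

open ColouredProp

variable {C : Type u} {S : Signature C}

/-- The value of a term in a prop, given an interpretation of the operations. -/
def Term.eval (P : ColouredProp C) (φ : ∀ o : S.Op, P.Hom (S.arity o) (S.coarity o)) :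
    ∀ {w v : List C}, Term S w v → P.Hom w v
  | _, _, .op o => φ o
  | _, _, .id w => P.id w
  | _, _, .sym w v => P.sym w v
  | _, _, .comp a b => P.comp (a.eval P φ) (b.eval P φ)
  | _, _, .tensor a b => P.tensor (a.eval P φ) (b.eval P φ)

theorem Term.eval_castHom (P : ColouredProp C)
    (φ : ∀ o : S.Op, P.Hom (S.arity o) (S.coarity o)) {w w' v v' : List C} (hw : w = w')
    (hv : v = v') (a : Term S w v) :
    (castHom (Term S) hw hv a).eval P φ = castHom P.Hom hw hv (a.eval P φ) := by
  subst hw hv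
  rfl

theorem TermEq.eval_eq {E : ∀ w v : List C, Term S w v → Term S w v → Prop} (P : ColouredProp C)
    (φ : ∀ o : S.Op, P.Hom (S.arity o) (S.coarity o))
    (hE : ∀ w v (a b : Term S w v), E w v a b → a.eval P φ = b.eval P φ) {w v : List C}
    {a b : Term S w v} (h : TermEq E a b) : a.eval P φ = b.eval P φ := by
  induction h with
  | eqn h => exact hE _ _ _ _ h
  | refl => rfl
  | symm _ ih => exact ih.symm
  | trans _ _ ih₁ ih₂ => exact ih₁.trans ih₂
  | comp_congr _ _ ih₁ ih₂ => simp only [Term.eval, ih₁, ih₂]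
  | tensor_congr _ _ ih₁ ih₂ => simp only [Term.eval, ih₁, ih₂]
  | id_comp => exact P.id_comp _
  | comp_id => exact P.comp_id _
  | assoc => exact P.assoc _ _ _
  | tensor_id => exact P.tensor_id _ _
  | tensor_comp => exact P.tensor_comp _ _ _ _
  | tensor_assoc => rw [Term.eval_castHom]; exact P.tensor_assoc _ _ _
  | unit_tensor => exact P.unit_tensor _
  | tensor_unit => rw [Term.eval_castHom]; exact P.tensor_unit _
  | sym_natural => exact P.sym_natural _ _
  | sym_sym => exact P.sym_sym _ _
  | hexagon w v z =>
    simp only [Term.eval, Term.eval_castHom]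
    exact P.hexagon w v z

namespace presentedProp

variable {E : ∀ w v : List C, Term S w v → Term S w v → Prop} {P : ColouredProp C}

/-- The morphism out of a presented prop given by an interpretation of the operations that
satisfies the equations. -/
def lift (φ : ∀ o : S.Op, P.Hom (S.arity o) (S.coarity o))
    (hE : ∀ w v (a b : Term S w v), E w v a b → a.eval P φ = b.eval P φ) :
    presentedProp S E ⟶ P where
  map := Quot.lift (fun a => a.eval P φ) fun _ _ h => h.eval_eq P φ hE
  map_id _ := rfl
  map_comp := by rintro w v z ⟨a⟩ ⟨b⟩; rfl
  map_tensor := by rintro w v w' v' ⟨a⟩ ⟨b⟩; rfl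
  map_sym _ _ := rfl

/-- A term is built from generators by operations that every prop morphism preserves, so its image
is determined by the images of the generators. -/
theorem map_mk (F : presentedProp S E ⟶ P) {w v : List C} (a : Term S w v) :
    F.map (Quot.mk _ a) = a.eval P fun o => F.map (gen o) := by
  induction a with
  | op o => rfl
  | id w => exact F.map_id w
  | sym w v => exact F.map_sym w v
  | comp a b iha ihb => exact F.map_comp_eq iha ihb
  | tensor a b iha ihb => exact F.map_tensor_eq iha ihb

theorem hom_ext {F G : presentedProp S E ⟶ P} (h : ∀ o, F.map (gen o) = G.map (gen o)) :
    F = G := by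
  apply Mor.ext
  funext w v f
  obtain ⟨a⟩ := f
  exact (map_mk F a).trans
    ((congrArg (fun φ => a.eval P φ) (funext h)).trans (map_mk G a).symm)

end presentedProp

/-! ### Models of the Frobenius equations in presented props -/

/-- Evaluating either side of an equation reduces to the matching side of a field of `IsFrobModel`.
This discharges the equations for every arrow out of a prop presented by them. -/
theorem FrobEq.eval_eq {ι : ∀ o : FrobOp C, Term S o.arity o.coarity} {P : ColouredProp C}
    {φ : ∀ o : S.Op, P.Hom (S.arity o) (S.coarity o)}
    (h : P.IsFrobModel fun o => (ι o).eval P φ) (w v : List C) (a b : Term S w v)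
    (hab : FrobEq ι w v a b) : a.eval P φ = b.eval P φ := by
  cases hab with
  | mul_comm c => exact h.mul_comm c
  | one_mul c => exact h.one_mul c
  | mul_assoc c => exact h.mul_assoc c
  | comul_comm c => exact h.comul_comm c
  | counit_comul c => exact h.counit_comul c
  | comul_assoc c => exact h.comul_assoc c
  | frob_left c => exact h.frob_left c
  | frob_right c => exact h.frob_right c
  | separable c => exact h.separable c

theorem isFrobModel_mk (ι : ∀ o : FrobOp C, Term S o.arity o.coarity) :
    (presentedProp S (FrobEq ι)).IsFrobModel fun o => Quot.mk _ (ι o) where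
  mul_comm c := Quot.sound (.eqn (.mul_comm c))
  one_mul c := Quot.sound (.eqn (.one_mul c))
  mul_assoc c := Quot.sound (.eqn (.mul_assoc c))
  comul_comm c := Quot.sound (.eqn (.comul_comm c))
  counit_comul c := Quot.sound (.eqn (.counit_comul c))
  comul_assoc c := Quot.sound (.eqn (.comul_assoc c))
  frob_left c := Quot.sound (.eqn (.frob_left c))
  frob_right c := Quot.sound (.eqn (.frob_right c))
  separable c := Quot.sound (.eqn (.separable c))

/-- The equations are written with composition, tensor, identities and symmetries alone, all of
which a prop morphism preserves. -/
theorem ColouredProp.IsFrobModel.map {P Q : ColouredProp C}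
    {φ : ∀ o : FrobOp C, P.Hom o.arity o.coarity} (h : P.IsFrobModel φ) (F : Mor P Q) :
    Q.IsFrobModel fun o => F.map (φ o) := by
  let ψ : ∀ o : FrobOp C, Q.Hom o.arity o.coarity := fun o => F.map (φ o)
  have m (c : C) : F.map (frobMul φ c) = frobMul ψ c := rfl
  have e (c : C) : F.map (frobOne φ c) = frobOne ψ c := rfl
  have d (c : C) : F.map (frobComul φ c) = frobComul ψ c := rfl
  have k (c : C) : F.map (frobCounit φ c) = frobCounit ψ c := rfl
  have i (c : C) : F.map (P.id [c]) = Q.id [c] := F.map_id [c]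
  have s (c : C) : F.map (P.sym [c] [c]) = Q.sym [c] [c] := F.map_sym [c] [c]
  exact
    { mul_comm := fun c => (F.map_comp_eq (s c) (m c)).symm.trans (congrArg F.map (h.mul_comm c))
      one_mul := fun c => (F.map_comp_eq (F.map_tensor_eq (e c) (i c)) (m c)).symm.trans
        ((congrArg F.map (h.one_mul c)).trans (i c))
      mul_assoc := fun c => (F.map_comp_eq (F.map_tensor_eq (m c) (i c)) (m c)).symm.trans
        ((congrArg F.map (h.mul_assoc c)).trans
          (F.map_comp_eq (F.map_tensor_eq (i c) (m c)) (m c)))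
      comul_comm := fun c =>
        (F.map_comp_eq (d c) (s c)).symm.trans (congrArg F.map (h.comul_comm c))
      counit_comul := fun c => (F.map_comp_eq (d c) (F.map_tensor_eq (k c) (i c))).symm.trans
        ((congrArg F.map (h.counit_comul c)).trans (i c))
      comul_assoc := fun c => (F.map_comp_eq (d c) (F.map_tensor_eq (d c) (i c))).symm.trans
        ((congrArg F.map (h.comul_assoc c)).trans
          (F.map_comp_eq (d c) (F.map_tensor_eq (i c) (d c))))
      frob_left := fun c => (F.map_comp_eq (v := [c, c, c]) (z := [c, c])
        (F.map_tensor_eq (d c) (i c)) (F.map_tensor_eq (i c) (m c))).symm.trans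
          ((congrArg F.map (h.frob_left c)).trans (F.map_comp_eq (m c) (d c)))
      frob_right := fun c => (F.map_comp_eq (v := [c, c, c]) (z := [c, c])
        (F.map_tensor_eq (i c) (d c)) (F.map_tensor_eq (m c) (i c))).symm.trans
          ((congrArg F.map (h.frob_right c)).trans (F.map_comp_eq (m c) (d c)))
      separable := fun c => (F.map_comp_eq (d c) (m c)).symm.trans
        ((congrArg F.map (h.separable c)).trans (i c)) }

/-! ### The free hypergraph category as a coproduct -/

/-- The morphism from the prop of Frobenius monoids given by a model. -/
def frobProp.lift {P : ColouredProp C} {φ : ∀ o : FrobOp C, P.Hom o.arity o.coarity}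
    (h : P.IsFrobModel φ) : frobProp C ⟶ P :=
  presentedProp.lift (S := frobSignature C) φ (FrobEq.eval_eq h)

/-- Converse to `frobProp.lift`: the generators form a model in the Frobenius prop, and `F` carries
it over. -/
theorem isFrobModel_of_frobProp {P : ColouredProp C} (F : frobProp C ⟶ P) :
    P.IsFrobModel fun o => F.map (presentedProp.gen (S := frobSignature C) o) :=
  (isFrobModel_mk fun o => Term.op (S := frobSignature C) o).map F

theorem isFrobModel_freeHyp (S : Signature C) : (freeHyp S).IsFrobModel fun o =>
    presentedProp.gen (S := S.sum (frobSignature C)) (Sum.inr o) :=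
  isFrobModel_mk fun o => Term.op (S := S.sum (frobSignature C)) (Sum.inr o)

/-- The morphism from a free prop given by an interpretation of the operations. -/
def synProp.lift {P : ColouredProp C} (φ : ∀ o : S.Op, P.Hom (S.arity o) (S.coarity o)) :
    synProp S ⟶ P :=
  presentedProp.lift φ fun _ _ _ _ h => h.elim

/-- The morphism from the free hypergraph category given by an interpretation of the operations
and a model of Frobenius monoids. -/
def freeHyp.lift {P : ColouredProp C} (φ : ∀ o : S.Op, P.Hom (S.arity o) (S.coarity o))
    {ψ : ∀ o : FrobOp C, P.Hom o.arity o.coarity} (h : P.IsFrobModel ψ) : freeHyp S ⟶ P :=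
  presentedProp.lift (S := S.sum (frobSignature C)) (fun | .inl o => φ o | .inr o => ψ o)
    (FrobEq.eval_eq h)

/-- The inclusion of the free prop in the free hypergraph category. -/
def freeHyp.inl (S : Signature C) : synProp S ⟶ freeHyp S :=
  synProp.lift fun o => presentedProp.gen (S := S.sum (frobSignature C)) (Sum.inl o)

/-- The inclusion of the prop of Frobenius monoids in the free hypergraph category. -/
def freeHyp.inr (S : Signature C) : frobProp C ⟶ freeHyp S :=
  frobProp.lift (isFrobModel_freeHyp S)

/-- The free hypergraph category is the coproduct of the free prop and the prop of Frobenius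
monoids. -/
def freeHyp.isColimit (S : Signature C) :
    Limits.IsColimit (Limits.BinaryCofan.mk (freeHyp.inl S) (freeHyp.inr S)) :=
  Limits.BinaryCofan.isColimitMk
    (fun s => freeHyp.lift (fun o => s.inl.map (presentedProp.gen o))
      (isFrobModel_of_frobProp s.inr))
    (fun _ => presentedProp.hom_ext fun _ => rfl)
    (fun _ => presentedProp.hom_ext fun _ => rfl)
    -- Every generator comes from one of the two summands, so `h₁` and `h₂` fix `m` on all of them.
    (fun s m h₁ h₂ => presentedProp.hom_ext fun o => by
      cases o with
      | inl o => exact congrArg (fun F : synProp S ⟶ s.pt => F.map (presentedProp.gen o)) h₁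
      | inr o =>
        exact congrArg (fun F : frobProp C ⟶ s.pt =>
          F.map (presentedProp.gen (S := frobSignature C) o)) h₂)

end Presented

/-! ### The main theorem -/

theorem mainTheorem8 {C : Type u} [Finite C] (S : Signature C) :
    Limits.HasBinaryCoproduct (synProp S) (frobProp C) ∧
    ∀ (P : ColouredProp C) (inl : synProp S ⟶ P) (inr : frobProp C ⟶ P),
      Nonempty (Limits.IsColimit (Limits.BinaryCofan.mk inl inr)) →
      ∃ (e : P ≅ freeHyp S)
        (hP : HypergraphCategory P.Obj) (hH : HypergraphCategory (freeHyp S).Obj),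
        (∀ o : S.Op, e.hom.map (inl.map (presentedProp.gen o)) =
          presentedProp.gen (S := S.sum (frobSignature C)) (Sum.inl o)) ∧
        (∀ o : FrobOp C,
          e.hom.map (inr.map (presentedProp.gen (S := frobSignature C) o)) =
            presentedProp.gen (S := S.sum (frobSignature C)) (Sum.inr o)) ∧
        ExtendsFrob hP (fun o => inr.map (presentedProp.gen (S := frobSignature C) o)) ∧
        ExtendsFrob hH (fun o =>
          presentedProp.gen (S := S.sum (frobSignature C)) (Sum.inr o)) ∧
        IsHypergraphMor hP hH e.hom ∧
        IsHypergraphMor hH hP e.inv ∧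
        ∀ (A : ColouredProp C) (hA : HypergraphCategory A.Obj)
          (φ : ∀ o : S.Op, A.Hom (S.arity o) (S.coarity o)),
          ∃! F : P ⟶ A,
            (∀ o : S.Op, F.map (inl.map (presentedProp.gen o)) = φ o) ∧
            IsHypergraphMor hP hA F := by
  refine ⟨⟨⟨_, freeHyp.isColimit S⟩⟩, fun P inl inr ⟨hc⟩ => ?_⟩
  let e : P ≅ freeHyp S := hc.coconePointUniqueUpToIso (freeHyp.isColimit S)
  have he₁ : inl ≫ e.hom = freeHyp.inl S :=
    hc.comp_coconePointUniqueUpToIso_hom (freeHyp.isColimit S) ⟨.left⟩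
  have he₂ : inr ≫ e.hom = freeHyp.inr S :=
    hc.comp_coconePointUniqueUpToIso_hom (freeHyp.isColimit S) ⟨.right⟩
  have he₃ : freeHyp.inr S ≫ e.inv = inr := by rw [← he₂, Category.assoc, e.hom_inv_id,
    Category.comp_id]
  have mP := isFrobModel_of_frobProp inr
  have mH := isFrobModel_freeHyp S
  -- Both structures are generated by the images of the Frobenius generators, which `e` matches; on
  -- letters `e.hom` and `e.inv` therefore preserve them, and that suffices.
  let hP := P.hypergraphOfFrobenius mP.frobeniusObj
  let hH := (freeHyp S).hypergraphOfFrobenius mH.frobeniusObj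
  have xP := ColouredProp.extendsFrob_hypergraphOfFrobenius mP
  have xH := ColouredProp.extendsFrob_hypergraphOfFrobenius mH
  have oP : P.frobOps hP = _ := ColouredProp.frobOps_eq_of_extendsFrob xP
  have oH : (freeHyp S).frobOps hH = _ := ColouredProp.frobOps_eq_of_extendsFrob xH
  have hinl (o : S.Op) : e.hom.map (inl.map (presentedProp.gen o)) =
      presentedProp.gen (S := S.sum (frobSignature C)) (Sum.inl o) :=
    congrArg (fun F : synProp S ⟶ freeHyp S => F.map (presentedProp.gen o)) he₁
  have hinr (o : FrobOp C) :
      e.hom.map (inr.map (presentedProp.gen (S := frobSignature C) o)) =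
        presentedProp.gen (S := S.sum (frobSignature C)) (Sum.inr o) :=
    congrArg (fun F : frobProp C ⟶ freeHyp S =>
      F.map (presentedProp.gen (S := frobSignature C) o)) he₂
  refine ⟨e, hP, hH, hinl, hinr, xP, xH, ?_, ?_, fun A hA φ => ?_⟩
  · refine ColouredProp.isHypergraphMor_of_frobOps hP hH e.hom fun o => ?_
    rw [oP, oH]
    exact hinr o
  · refine ColouredProp.isHypergraphMor_of_frobOps hH hP e.inv fun o => ?_
    rw [oP, oH]
    have h := congrArg (fun F : frobProp C ⟶ P =>
      F.map (presentedProp.gen (S := frobSignature C) o)) he₃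
    exact h
  -- The Frobenius summand is sent to the operations that `hA` puts on letters, the only choice open
  -- to a hypergraph morphism.
  · obtain ⟨F, hF₁, hF₂⟩ := Limits.BinaryCofan.IsColimit.desc' hc (synProp.lift φ)
      (frobProp.lift (A.isFrobModel_frobOps hA))
    refine ⟨F, ⟨fun o => ?_, ?_⟩, fun G ⟨hG₁, hG₂⟩ => ?_⟩
    · exact congrArg (fun F : synProp S ⟶ A => F.map (presentedProp.gen o)) hF₁
    · refine ColouredProp.isHypergraphMor_of_frobOps hP hA F fun o => ?_
      rw [oP]
      exact congrArg (fun F : frobProp C ⟶ A =>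
        F.map (presentedProp.gen (S := frobSignature C) o)) hF₂
    · refine Limits.BinaryCofan.IsColimit.hom_ext hc (Eq.trans ?_ hF₁.symm)
        (Eq.trans ?_ hF₂.symm)
      · exact presentedProp.hom_ext hG₁
      · refine presentedProp.hom_ext fun o => ?_
        -- Preserving the structure on letters determines `G` on the Frobenius generators, hence on
        -- the second summand.
        have h := ColouredProp.map_frobOps_of_isHypergraphMor hG₂ o
        rw [oP] at h
        exact h
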